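/- All Banach spaces are over a fixed scalar field $\mathbb K\in\{\mathbb R,\mathbb C\}$; $E'$ and $E''$ denote the dual and the bidual of $E$, $j_E:E\to E''$ is the canonical embedding, $\mathcal L(E,F)$ is the space of bounded operators and $\mathcal F(E,F)$ the space of those of finite rank. A Banach ideal $(\mathcal A,\mathbf A)$ is a Banach operator ideal in the sense of Pietsch: every component $\mathcal A(E,F)\subseteq\mathcal L(E,F)$ is a linear space, complete under the norm $\mathbf A$; rank one operators $a\otimes y$ belong to it and $\mathbf A(a\otimes y)=\|a\|\,\|y\|$; and $RST\in\mathcal A$ with $\mathbf A(RST)\le\|R\|\,\mathbf A(S)\,\|T\|$ whenever $S\in\mathcal A$ and $R,T$ are bounded. Maximality: $(\mathcal A,\mathbf A)$ is maximal if it coincides isometrically with its maximal hull, the two-sided quotient $\overline{\mathcal F}^{-1}\circ\mathcal A\circ\overline{\mathcal F}^{-1}$ by the ideal $\overline{\mathcal F}$ of approximable operators (operator norm limits of finite rank operators): it consists of the $T$ such that $RTS\in\mathcal A$ for all composable approximable $R,S$, with norm $\sup\{\mathbf A(RTS):R,S \text{ approximable},\ \|R\|=\|S\|=1\}$. Adjoint: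 $T\in\mathcal L(E,F)$ belongs to $\mathcal A^*(E,F)$ if there is $c\ge 0$ such that $|\operatorname{tr}(TBSR)|\le c\,\|B\|\,\mathbf A(S)\,\|R\|$ for all Banach spaces $E_0,F_0$ and all $B\in\mathcal F(E_0,E)$, $S\in\mathcal A(F_0,E_0)$, $R\in\mathcal F(F,F_0)$; $\mathbf A^*(T)$ is the infimum of these $c$. Write $\mathcal A^{**}=(\mathcal A^*)^*$ and $\mathcal A^{***}=(\mathcal A^{**})^*$, and similarly for the norms. Extension property: $(\mathcal A,\mathbf A)$ has the $\mathcal A$-extension property if for every $\varepsilon>0$, every linear isometric embedding $J:E\to G$ of Banach spaces and every $T\in\mathcal A(E,F)$ there is $\tilde T\in\mathcal A(G,F)$ with $T=\tilde TJ$ and $\mathbf A(\tilde T)\le(1+\varepsilon)\,\mathbf A(T)$. **Corollary 4.1.** Let $(\mathcal A,\mathbf A)$ be a maximal Banach ideal with the $\mathcal A$-extension property. Then the principle of $\mathcal A^*$-local reflexivity holds: for every finite-dimensional normed space $M$, every Banach space $F$, every finite-dimensional subspace $N\subseteq F'$, every $T\in\mathcal L(M,F'')$ and every $\varepsilon>0$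 there is $S\in\mathcal A^*(M,F)$ such that 1. $\mathbf A^*(S)\le(1+\varepsilon)\,\mathbf A^{***}(T)$; 2. $\langle Sx,b\rangle=\langle b,Tx\rangle$ for all $x\in M$, $b\in N$; 3. $j_F(Sx)=Tx$ for all $x\in M$ with $Tx\in j_F(F)$. Moreover, the same holds with (1) replaced by $\mathbf A^*(S)\le(1+\varepsilon)\,\mathbf A^*(T)$; that is, in the norm estimate of the classical principle of local reflexivity the operator norm may be replaced by the adjoint ideal norm $\mathbf A^*$. -/

import Mathlib

open Filter Topology

universe u

noncomputable section

/-- A class of bounded operators between Banach spaces over `𝕜`, together with a size function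
on it: for every pair of Banach spaces `E`, `F`, a set of operators `E → F` (the component of the
class at `(E, F)`) and a real number for each operator.  The value of `norm` at operators which do
not belong to the class is irrelevant.  No laws are imposed here: they are collected in
`OpClass.IsBanachIdeal`. -/
structure OpClass (𝕜 : Type) [RCLike 𝕜] where
  mem : ∀ {E F : Type u} [NormedAddCommGroup E] [NormedSpace 𝕜 E] [CompleteSpace E]
    [NormedAddCommGroup F] [NormedSpace 𝕜 F] [CompleteSpace F], (E →L[𝕜] F) → Prop
  norm : ∀ {E F : Type u} [NormedAddCommGroup E] [NormedSpace 𝕜 E] [CompleteSpace E]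
    [NormedAddCommGroup F] [NormedSpace 𝕜 F] [CompleteSpace F], (E →L[𝕜] F) → ℝ

/-- `T` is a finite operator: its range is finite-dimensional. -/
def FiniteRank {𝕜 : Type} [RCLike 𝕜] {E F : Type u} [NormedAddCommGroup E] [NormedSpace 𝕜 E]
    [NormedAddCommGroup F] [NormedSpace 𝕜 F] (T : E →L[𝕜] F) : Prop :=
  FiniteDimensional 𝕜 (LinearMap.range (T : E →ₗ[𝕜] F))

/-- The trace of a finite rank operator `U` on a (possibly infinite-dimensional) space: the trace
of the endomorphism which `U` induces on its (finite-dimensional) range. -/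
def finTrace {𝕜 : Type} [RCLike 𝕜] {E : Type u} [NormedAddCommGroup E] [NormedSpace 𝕜 E]
    (U : E →L[𝕜] E) : 𝕜 :=
  LinearMap.trace 𝕜 (LinearMap.range (U : E →ₗ[𝕜] E))
    ((U : E →ₗ[𝕜] E).rangeRestrict ∘ₗ (LinearMap.range (U : E →ₗ[𝕜] E)).subtype)

namespace OpClass

/-- A Banach (operator) ideal: every component is a linear space containing the rank one
operators `x ↦ a x • y`, on which `norm` is a complete norm, normalised by `‖a‖ * ‖y‖` on rank one
operators, and `R ∘ S ∘ T` belongs to the class, with norm at most `‖R‖ * norm S * ‖T‖`,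
whenever `S` does. -/
structure IsBanachIdeal {𝕜 : Type} [RCLike 𝕜] (A : OpClass.{u} 𝕜) : Prop where
  add_mem : ∀ {E F : Type u} [NormedAddCommGroup E] [NormedSpace 𝕜 E] [CompleteSpace E]
    [NormedAddCommGroup F] [NormedSpace 𝕜 F] [CompleteSpace F] (S T : E →L[𝕜] F),
    A.mem S → A.mem T → A.mem (S + T)
  smul_mem : ∀ {E F : Type u} [NormedAddCommGroup E] [NormedSpace 𝕜 E] [CompleteSpace E]
    [NormedAddCommGroup F] [NormedSpace 𝕜 F] [CompleteSpace F] (c : 𝕜) (T : E →L[𝕜] F),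
    A.mem T → A.mem (c • T)
  norm_add_le : ∀ {E F : Type u} [NormedAddCommGroup E] [NormedSpace 𝕜 E] [CompleteSpace E]
    [NormedAddCommGroup F] [NormedSpace 𝕜 F] [CompleteSpace F] (S T : E →L[𝕜] F),
    A.mem S → A.mem T → A.norm (S + T) ≤ A.norm S + A.norm T
  norm_smul : ∀ {E F : Type u} [NormedAddCommGroup E] [NormedSpace 𝕜 E] [CompleteSpace E]
    [NormedAddCommGroup F] [NormedSpace 𝕜 F] [CompleteSpace F] (c : 𝕜) (T : E →L[𝕜] F),
    A.mem T → A.norm (c • T) = ‖c‖ * A.norm T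
  eq_zero_of_norm : ∀ {E F : Type u} [NormedAddCommGroup E] [NormedSpace 𝕜 E] [CompleteSpace E]
    [NormedAddCommGroup F] [NormedSpace 𝕜 F] [CompleteSpace F] (T : E →L[𝕜] F),
    A.mem T → A.norm T = 0 → T = 0
  rankOne_mem : ∀ {E F : Type u} [NormedAddCommGroup E] [NormedSpace 𝕜 E] [CompleteSpace E]
    [NormedAddCommGroup F] [NormedSpace 𝕜 F] [CompleteSpace F] (a : StrongDual 𝕜 E) (y : F),
    A.mem (ContinuousLinearMap.smulRight a y)
  norm_rankOne : ∀ {E F : Type u} [NormedAddCommGroup E] [NormedSpace 𝕜 E] [CompleteSpace E]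
    [NormedAddCommGroup F] [NormedSpace 𝕜 F] [CompleteSpace F] (a : StrongDual 𝕜 E) (y : F),
    A.norm (ContinuousLinearMap.smulRight a y) = ‖a‖ * ‖y‖
  comp_mem : ∀ {D E F G : Type u} [NormedAddCommGroup D] [NormedSpace 𝕜 D] [CompleteSpace D]
    [NormedAddCommGroup E] [NormedSpace 𝕜 E] [CompleteSpace E]
    [NormedAddCommGroup F] [NormedSpace 𝕜 F] [CompleteSpace F]
    [NormedAddCommGroup G] [NormedSpace 𝕜 G] [CompleteSpace G]
    (R : F →L[𝕜] G) (S : E →L[𝕜] F) (T : D →L[𝕜] E),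
    A.mem S → A.mem (R ∘L S ∘L T)
  norm_comp_le : ∀ {D E F G : Type u} [NormedAddCommGroup D] [NormedSpace 𝕜 D] [CompleteSpace D]
    [NormedAddCommGroup E] [NormedSpace 𝕜 E] [CompleteSpace E]
    [NormedAddCommGroup F] [NormedSpace 𝕜 F] [CompleteSpace F]
    [NormedAddCommGroup G] [NormedSpace 𝕜 G] [CompleteSpace G]
    (R : F →L[𝕜] G) (S : E →L[𝕜] F) (T : D →L[𝕜] E),
    A.mem S → A.norm (R ∘L S ∘L T) ≤ ‖R‖ * A.norm S * ‖T‖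
  complete : ∀ {E F : Type u} [NormedAddCommGroup E] [NormedSpace 𝕜 E] [CompleteSpace E]
    [NormedAddCommGroup F] [NormedSpace 𝕜 F] [CompleteSpace F] (T : ℕ → E →L[𝕜] F),
    (∀ n, A.mem (T n)) →
    (∀ ε : ℝ, 0 < ε → ∃ n₀ : ℕ, ∀ m n : ℕ, n₀ ≤ m → n₀ ≤ n → A.norm (T m - T n) < ε) →
    ∃ S : E →L[𝕜] F, A.mem S ∧ Tendsto (fun n => A.norm (T n - S)) atTop (𝓝 0)

/-- The isometric identity of two classes: they have the same members, on which the two norms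
agree. -/
def IsometricEq {𝕜 : Type} [RCLike 𝕜] (A B : OpClass.{u} 𝕜) : Prop :=
  ∀ {E F : Type u} [NormedAddCommGroup E] [NormedSpace 𝕜 E] [CompleteSpace E]
    [NormedAddCommGroup F] [NormedSpace 𝕜 F] [CompleteSpace F] (T : E →L[𝕜] F),
    (A.mem T ↔ B.mem T) ∧ (A.mem T → A.norm T = B.norm T)

/-- The approximable operators: the operator norm closure of the finite operators, with the
operator norm. -/
def approximable (𝕜 : Type) [RCLike 𝕜] : OpClass.{u} 𝕜 where
  mem := fun {E F} _ _ _ _ _ _ T => T ∈ closure {S : E →L[𝕜] F | FiniteRank S}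
  norm := fun T => ‖T‖

/-- The right `B`-quotient `A ∘ B⁻¹`: all `T` with `T ∘ S` in `A` for every `S` in `B`, normed by
the supremum of `A (T ∘ S)` over the `S` with `B S = 1`.  (For Banach ideals `A`, `B` this supremum
is finite whenever `T` belongs to the quotient.) -/
def rightQuotient {𝕜 : Type} [RCLike 𝕜] (A B : OpClass.{u} 𝕜) : OpClass.{u} 𝕜 where
  mem := fun {E _} _ _ _ _ _ _ T =>
    ∀ (G : Type u) [NormedAddCommGroup G] [NormedSpace 𝕜 G] [CompleteSpace G] (S : G →L[𝕜] E),
      B.mem S → A.mem (T ∘L S)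
  norm := fun {E _} _ _ _ _ _ _ T =>
    sSup {r : ℝ | ∃ (G : Type u) (_ : NormedAddCommGroup G) (_ : NormedSpace 𝕜 G)
      (_ : CompleteSpace G) (S : G →L[𝕜] E), B.mem S ∧ B.norm S = 1 ∧ r = A.norm (T ∘L S)}

/-- The left `B`-quotient `B⁻¹ ∘ A`: all `T` with `S ∘ T` in `A` for every `S` in `B`, normed by
the supremum of `A (S ∘ T)` over the `S` with `B S = 1`.  (For Banach ideals `A`, `B` this supremum
is finite whenever `T` belongs to the quotient.) -/
def leftQuotient {𝕜 : Type} [RCLike 𝕜] (B A : OpClass.{u} 𝕜) : OpClass.{u} 𝕜 where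
  mem := fun {_ F} _ _ _ _ _ _ T =>
    ∀ (G : Type u) [NormedAddCommGroup G] [NormedSpace 𝕜 G] [CompleteSpace G] (S : F →L[𝕜] G),
      B.mem S → A.mem (S ∘L T)
  norm := fun {_ F} _ _ _ _ _ _ T =>
    sSup {r : ℝ | ∃ (G : Type u) (_ : NormedAddCommGroup G) (_ : NormedSpace 𝕜 G)
      (_ : CompleteSpace G) (S : F →L[𝕜] G), B.mem S ∧ B.norm S = 1 ∧ r = A.norm (S ∘L T)}

/-- The maximal hull of `A`: the two-sided quotient of `A` by the approximable operators. -/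
def maximalHull {𝕜 : Type} [RCLike 𝕜] (A : OpClass.{u} 𝕜) : OpClass.{u} 𝕜 :=
  leftQuotient (approximable 𝕜) (rightQuotient A (approximable 𝕜))

/-- `A` is maximal if it coincides isometrically with its maximal hull. -/
def IsMaximal {𝕜 : Type} [RCLike 𝕜] (A : OpClass.{u} 𝕜) : Prop :=
  A.IsometricEq A.maximalHull

/-- The constants `c ≥ 0` admissible in the definition of the adjoint of `A` at `T : E → F`:
`|tr (T B S R)| ≤ c * ‖B‖ * A(S) * ‖R‖` for all finite `B : E₀ → E`, all `S : F₀ → E₀` in `A` and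
all finite `R : F → F₀`. -/
def adjointConstants {𝕜 : Type} [RCLike 𝕜] (A : OpClass.{u} 𝕜) {E F : Type u}
    [NormedAddCommGroup E] [NormedSpace 𝕜 E] [NormedAddCommGroup F] [NormedSpace 𝕜 F]
    (T : E →L[𝕜] F) : Set ℝ :=
  {c : ℝ | 0 ≤ c ∧ ∀ (E₀ F₀ : Type u)
    [NormedAddCommGroup E₀] [NormedSpace 𝕜 E₀] [CompleteSpace E₀]
    [NormedAddCommGroup F₀] [NormedSpace 𝕜 F₀] [CompleteSpace F₀]
    (B : E₀ →L[𝕜] E) (S : F₀ →L[𝕜] E₀) (R : F →L[𝕜] F₀),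
    FiniteRank B → A.mem S → FiniteRank R →
      ‖finTrace (T ∘L B ∘L S ∘L R)‖ ≤ c * ‖B‖ * A.norm S * ‖R‖}

/-- The adjoint `A*` of `A`. -/
def adjoint {𝕜 : Type} [RCLike 𝕜] (A : OpClass.{u} 𝕜) : OpClass.{u} 𝕜 where
  mem := fun T => (A.adjointConstants T).Nonempty
  norm := fun T => sInf (A.adjointConstants T)

/-- The `A`-extension property: operators in `A` extend along metric injections, with almost the
same `A`-norm. -/
def HasExtensionProperty {𝕜 : Type} [RCLike 𝕜] (A : OpClass.{u} 𝕜) : Prop :=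
  ∀ (ε : ℝ), 0 < ε → ∀ (E F G : Type u)
    [NormedAddCommGroup E] [NormedSpace 𝕜 E] [CompleteSpace E]
    [NormedAddCommGroup F] [NormedSpace 𝕜 F] [CompleteSpace F]
    [NormedAddCommGroup G] [NormedSpace 𝕜 G] [CompleteSpace G]
    (J : E →ₗᵢ[𝕜] G) (T : E →L[𝕜] F), A.mem T →
    ∃ T' : G →L[𝕜] F, A.mem T' ∧ T = T' ∘L J.toContinuousLinearMap ∧
      A.norm T' ≤ (1 + ε) * A.norm T

/-- Local reflexivity with the norm estimate `A(S) ≤ (1 + ε) * B(T)`: for every finite-dimensional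
`M`, every Banach space `F`, every `T : M → F''`, every finite-dimensional subspace `N` of `F'` and
every `ε > 0` there is `S : M → F` satisfying this estimate, with `⟨S x, b⟩ = ⟨b, T x⟩` for `x ∈ M`
and `b ∈ N`, and with `S x = T x` (in `F''`) whenever `T x` lies in the canonical image of `F`. -/
def LocalReflexivityWith {𝕜 : Type} [RCLike 𝕜] (A B : OpClass.{u} 𝕜) : Prop :=
  ∀ (M F : Type u) [NormedAddCommGroup M] [NormedSpace 𝕜 M] [CompleteSpace M]
    [FiniteDimensional 𝕜 M] [NormedAddCommGroup F] [NormedSpace 𝕜 F] [CompleteSpace F]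
    (N : Submodule 𝕜 (StrongDual 𝕜 F)) [FiniteDimensional 𝕜 N]
    (T : M →L[𝕜] StrongDual 𝕜 (StrongDual 𝕜 F)) (ε : ℝ), 0 < ε →
    ∃ S : M →L[𝕜] F, A.mem S ∧ A.norm S ≤ (1 + ε) * B.norm (E := M) (F := StrongDual 𝕜 (StrongDual 𝕜 F)) T ∧
      (∀ x : M, ∀ b ∈ N, b (S x) = T x b) ∧
      (∀ x : M, T x ∈ Set.range (NormedSpace.inclusionInDoubleDual 𝕜 F) →
        NormedSpace.inclusionInDoubleDual 𝕜 F (S x) = T x)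

/-- The principle of `A`-local reflexivity (`A`-LRP): local reflexivity holds with the estimate
`A(S) ≤ (1 + ε) * A**(T)`. -/
def LRP {𝕜 : Type} [RCLike 𝕜] (A : OpClass.{u} 𝕜) : Prop :=
  A.LocalReflexivityWith A.adjoint.adjoint

end OpClass

end

/-! Local reflexivity is a separation argument in `L(M, F)`. The operators agreeing with `T` as
required contain a coset `S₀ + Y`. If `A*` were at least `(1 + ε) A*(T)` on this coset, Hahn–Banach
would give a functional `S ↦ tr (V S)`, dominated by `A*`, zero on `Y`, equal to that constant at
`S₀`. Vanishing on `Y` forces `tr (V'' T) = tr (V S₀)` (`exists_local_reflexive`), so it suffices to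
prove `|tr (V'' T)| ≤ A*(T)`. This follows from two facts.

Domination by `A*` implies `A(V) ≤ 1` (`norm_le_one_of_isMaximal`): on finite-dimensional subspaces
this is trace duality, and maximality recovers `A(V)` from such restrictions.

Moreover `|tr (V'' T)| ≤ A*(T) A(V)` (`norm_opTrace_bidualExt_comp_le`). The definition of `A*`
tests only against finite rank operators; the extension property lets `V` factor through some
`ℓ∞(Γ)`, whose metric approximation property supplies them. The bidual is handled by pulling the
range of `T` back to `F` by a weak classical local reflexivity and extending again.

The version with `A***` follows from `A* ≤ A***`. -/

set_option maxSynthPendingDepth 3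

/-- Hahn–Banach: a functional dominated by a seminorm `p`, vanishing on a subspace `Y`, which is
at least `c` at a point whose `p`-distance from `Y` is at least `c`. -/
theorem Seminorm.exists_dual_of_forall_le {𝕜 X : Type*} [RCLike 𝕜] [AddCommGroup X] [Module 𝕜 X]
    (p : Seminorm 𝕜 X) (Y : Submodule 𝕜 X) (x₀ : X) {c : ℝ} (hc : 0 < c)
    (h : ∀ y ∈ Y, c ≤ p (x₀ + y)) :
    ∃ f : Module.Dual 𝕜 X, (∀ x, ‖f x‖ ≤ p x) ∧ (∀ y ∈ Y, f y = 0) ∧ f x₀ = (c : 𝕜) := by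
  have hx₀ : x₀ ∉ Y := fun hx => by
    have := h (-x₀) (Y.neg_mem hx)
    simp only [add_neg_cancel, map_zero] at this
    linarith
  obtain ⟨g, hg0, hgY⟩ := Submodule.exists_le_ker_of_notMem hx₀
  -- The functional is `y + a x₀ ↦ a c`. By homogeneity, domination by `p` is exactly the distance
  -- hypothesis at `a⁻¹ y`.
  have hbd : ∀ x : (Y ⊔ Submodule.span 𝕜 {x₀} : Submodule 𝕜 X),
      ‖(((c : 𝕜) * (g x₀)⁻¹) • g).domRestrict (Y ⊔ Submodule.span 𝕜 {x₀}) x‖ ≤ p x := by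
    rintro ⟨x, hx⟩
    obtain ⟨y, hy, z, hz, rfl⟩ := Submodule.mem_sup.1 hx
    obtain ⟨a, rfl⟩ := Submodule.mem_span_singleton.1 hz
    have hgy : g y = 0 := hgY hy
    simp only [LinearMap.domRestrict_apply, LinearMap.smul_apply, map_add, hgy, map_smul,
      smul_eq_mul]
    by_cases ha : a = 0
    · simp [ha, apply_nonneg]
    · have h1 : p (y + a • x₀) = ‖a‖ * p (x₀ + a⁻¹ • y) := by
        rw [← map_smul_eq_mul, smul_add, smul_smul, mul_inv_cancel₀ ha, one_smul, add_comm]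
      have h2 : (c : 𝕜) * (g x₀)⁻¹ * 0 + a * (c * (g x₀)⁻¹ * g x₀) = a * c := by
        rw [mul_zero, zero_add, inv_mul_cancel_right₀ hg0]
      rw [h1, h2, norm_mul, RCLike.norm_ofReal, abs_of_pos hc]
      exact mul_le_mul_of_nonneg_left (h _ (Y.smul_mem _ hy)) (norm_nonneg a)
  obtain ⟨f, hf, hfp⟩ := Module.Dual.exists_extension_of_le_seminorm _ _ hbd
  refine ⟨f, hfp, fun y hy => ?_, ?_⟩
  · have hgy : g y = 0 := hgY hy
    have := hf ⟨y, Submodule.mem_sup_left hy⟩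
    simpa [hgy] using this
  · have := hf ⟨x₀, Submodule.mem_sup_right (Submodule.mem_span_singleton_self x₀)⟩
    simpa [hg0] using this

noncomputable section

variable {𝕜 : Type} [RCLike 𝕜]

/-! ### Traces, finite rank operators and second adjoints -/

/-- The trace of a bounded operator (meaningful on finite-dimensional spaces). -/
def opTrace {M : Type*} [NormedAddCommGroup M] [NormedSpace 𝕜 M] : (M →L[𝕜] M) →ₗ[𝕜] 𝕜 :=
  LinearMap.trace 𝕜 M ∘ₗ ContinuousLinearMap.coeLM 𝕜

section Trace

variable {M H E F G : Type u}
  [NormedAddCommGroup M] [NormedSpace 𝕜 M] [FiniteDimensional 𝕜 M]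
  [NormedAddCommGroup H] [NormedSpace 𝕜 H] [FiniteDimensional 𝕜 H]
  [NormedAddCommGroup E] [NormedSpace 𝕜 E]
  [NormedAddCommGroup F] [NormedSpace 𝕜 F]
  [NormedAddCommGroup G] [NormedSpace 𝕜 G]

theorem opTrace_comm (X : M →L[𝕜] H) (Y : H →L[𝕜] M) : opTrace (X ∘L Y) = opTrace (Y ∘L X) :=
  LinearMap.trace_comp_comm' (Y : H →ₗ[𝕜] M) (X : M →ₗ[𝕜] H)

theorem opTrace_smulRight (a : StrongDual 𝕜 M) (x : M) :
    opTrace (ContinuousLinearMap.smulRight a x) = a x :=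
  LinearMap.trace_smulRight (a : M →ₗ[𝕜] 𝕜) x

theorem exists_norm_opTrace_le (𝕜 : Type) [RCLike 𝕜] (M : Type u) [NormedAddCommGroup M]
    [NormedSpace 𝕜 M] [FiniteDimensional 𝕜 M] :
    ∃ C : ℝ, 0 ≤ C ∧ ∀ U : M →L[𝕜] M, ‖opTrace U‖ ≤ C * ‖U‖ :=
  ⟨_, norm_nonneg _, (LinearMap.toContinuousLinearMap (opTrace (𝕜 := 𝕜) (M := M))).le_opNorm⟩

/-- The coordinate functionals of the standard basis of a finite-dimensional space. -/
def coordL (𝕜 : Type) [RCLike 𝕜] (M : Type u) [NormedAddCommGroup M] [NormedSpace 𝕜 M]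
    [FiniteDimensional 𝕜 M] (i : Fin (Module.finrank 𝕜 M)) : StrongDual 𝕜 M :=
  LinearMap.toContinuousLinearMap ((Module.finBasis 𝕜 M).coord i)

theorem sum_coordL_smul (x : M) :
    ∑ i, coordL 𝕜 M i x • Module.finBasis 𝕜 M i = x :=
  (Module.finBasis 𝕜 M).sum_repr x

theorem eq_sum_smulRight_of_range (V : F →L[𝕜] M) :
    V = ∑ i, ContinuousLinearMap.smulRight (coordL 𝕜 M i ∘L V) (Module.finBasis 𝕜 M i) := by
  ext y
  simpa using (sum_coordL_smul (𝕜 := 𝕜) (V y)).symm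

theorem eq_sum_smulRight_of_domain (S : M →L[𝕜] F) :
    S = ∑ i, ContinuousLinearMap.smulRight (coordL 𝕜 M i) (S (Module.finBasis 𝕜 M i)) := by
  ext y
  simpa using congrArg S (sum_coordL_smul (𝕜 := 𝕜) y).symm

theorem finiteRank_of_domain (S : M →L[𝕜] F) : FiniteRank S :=
  inferInstanceAs (FiniteDimensional 𝕜 (LinearMap.range (S : M →ₗ[𝕜] F)))

theorem finiteRank_of_range (S : F →L[𝕜] M) : FiniteRank S :=
  inferInstanceAs (FiniteDimensional 𝕜 (LinearMap.range (S : F →ₗ[𝕜] M)))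

theorem FiniteRank.comp_left {S : E →L[𝕜] F} (hS : FiniteRank S) (R : F →L[𝕜] G) :
    FiniteRank (R ∘L S) := by
  unfold FiniteRank at *
  rw [ContinuousLinearMap.toLinearMap_comp, LinearMap.range_comp]
  infer_instance

theorem FiniteRank.comp_right {S : F →L[𝕜] G} (hS : FiniteRank S) (R : E →L[𝕜] F) :
    FiniteRank (S ∘L R) := by
  unfold FiniteRank at *
  rw [ContinuousLinearMap.toLinearMap_comp]
  exact Submodule.finiteDimensional_of_le (LinearMap.range_comp_le_range _ _)

theorem FiniteRank.exists_factorization {S : E →L[𝕜] F} (hS : FiniteRank S) :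
    ∃ S₀ : E →L[𝕜] LinearMap.range (S : E →ₗ[𝕜] F),
      S = (LinearMap.range (S : E →ₗ[𝕜] F)).subtypeL ∘L S₀ ∧ ‖S₀‖ ≤ ‖S‖ := by
  refine ⟨S.codRestrict _ fun x => ⟨x, rfl⟩, rfl, ?_⟩
  exact ContinuousLinearMap.opNorm_le_bound _ (norm_nonneg _) fun x => S.le_opNorm x

/-- The trace of an operator factoring through a finite-dimensional space. -/
theorem finTrace_comp_eq_opTrace (X : M →L[𝕜] F) (Y : F →L[𝕜] M) :
    finTrace (X ∘L Y) = opTrace (Y ∘L X) := by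
  set K := LinearMap.range ((X ∘L Y : F →L[𝕜] F) : F →ₗ[𝕜] F) with hK
  set L := LinearMap.range (X : M →ₗ[𝕜] F) with hL
  have hKL : K ≤ L := LinearMap.range_comp_le_range (Y : F →ₗ[𝕜] M) (X : M →ₗ[𝕜] F)
  have : FiniteDimensional 𝕜 K := Submodule.finiteDimensional_of_le hKL
  -- Both traces are compared with that of `X ∘L Y` acting on `L`, the range of `X`.
  have h1 := LinearMap.trace_comp_comm' (Submodule.inclusion hKL)
    (((X ∘L Y : F →L[𝕜] F) : F →ₗ[𝕜] F).rangeRestrict ∘ₗ L.subtype)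
  have h2 := LinearMap.trace_comp_comm' (X : M →ₗ[𝕜] F).rangeRestrict
    ((Y : F →ₗ[𝕜] M) ∘ₗ L.subtype)
  exact h1.trans h2.symm

theorem finTrace_comp_comm (X : E →L[𝕜] F) (Y : F →L[𝕜] E) (hX : FiniteRank X) :
    finTrace (X ∘L Y) = finTrace (Y ∘L X) := by
  have : FiniteDimensional 𝕜 (LinearMap.range (X : E →ₗ[𝕜] F)) := hX
  obtain ⟨X₀, hX₀, -⟩ := hX.exists_factorization
  set ι := (LinearMap.range (X : E →ₗ[𝕜] F)).subtypeL
  have h1 := finTrace_comp_eq_opTrace ι (X₀ ∘L Y)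
  have h2 := finTrace_comp_eq_opTrace (Y ∘L ι) X₀
  rw [← ContinuousLinearMap.comp_assoc, ← hX₀] at h1
  rw [ContinuousLinearMap.comp_assoc, ← hX₀, ← ContinuousLinearMap.comp_assoc] at h2
  exact h1.trans h2.symm

/-- Functionals on `L(M, F)`, for finite-dimensional `M`, are given by trace duality. -/
theorem exists_opTrace_eq (f : Module.Dual 𝕜 (M →L[𝕜] F)) {C : ℝ} (hf : ∀ S, ‖f S‖ ≤ C * ‖S‖) :
    ∃ V : F →L[𝕜] M, ∀ S, f S = opTrace (V ∘L S) := by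
  set f' : (M →L[𝕜] F) →L[𝕜] 𝕜 := f.mkContinuous C hf
  -- The rows of `V` are read off from `f` on the rank one operators built on the coordinate
  -- functionals.
  let φ : Fin (Module.finrank 𝕜 M) → StrongDual 𝕜 F := fun i =>
    f' ∘L (ContinuousLinearMap.smulRightL 𝕜 M F (coordL 𝕜 M i))
  refine ⟨∑ i, ContinuousLinearMap.smulRight (φ i) (Module.finBasis 𝕜 M i), fun S => ?_⟩
  have h1 : f S = ∑ i, φ i (S (Module.finBasis 𝕜 M i)) := by
    conv_lhs => rw [eq_sum_smulRight_of_domain S, map_sum]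
    rfl
  have h2 : (∑ i, ContinuousLinearMap.smulRight (φ i) (Module.finBasis 𝕜 M i)) ∘L S =
      ∑ i, ContinuousLinearMap.smulRight (φ i ∘L S) (Module.finBasis 𝕜 M i) := by
    ext x; simp
  rw [h1, h2, map_sum]
  exact Finset.sum_congr rfl fun i _ => (opTrace_smulRight (φ i ∘L S) _).symm

/-- The operator `F'' → M` extending `V : F → M`, for finite-dimensional `M` (that is, the second
adjoint of `V`). -/
def bidualExt (V : F →L[𝕜] M) : StrongDual 𝕜 (StrongDual 𝕜 F) →L[𝕜] M :=
  ∑ i, ContinuousLinearMap.smulRight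
    (NormedSpace.inclusionInDoubleDual 𝕜 (StrongDual 𝕜 F) (coordL 𝕜 M i ∘L V))
    (Module.finBasis 𝕜 M i)

theorem bidualExt_apply (V : F →L[𝕜] M) (z : StrongDual 𝕜 (StrongDual 𝕜 F)) :
    bidualExt V z = ∑ i, z (coordL 𝕜 M i ∘L V) • Module.finBasis 𝕜 M i := by
  simp [bidualExt]

/-- Frees `bidualExt` from its basis: since functionals separate the points of `M`, this identity
characterises it. -/
theorem dual_bidualExt (V : F →L[𝕜] M) (z : StrongDual 𝕜 (StrongDual 𝕜 F)) (a : StrongDual 𝕜 M) :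
    a (bidualExt V z) = z (a ∘L V) := by
  have : a ∘L V = ∑ i, a (Module.finBasis 𝕜 M i) • (coordL 𝕜 M i ∘L V) := by
    ext y
    have := congrArg a (sum_coordL_smul (𝕜 := 𝕜) (V y))
    simp only [map_sum, map_smul, smul_eq_mul] at this
    simp [← this, mul_comm]
  rw [this, bidualExt_apply, map_sum, map_sum]
  simp [mul_comm]

theorem eq_of_forall_dual_eq {x y : M} (h : ∀ a : StrongDual 𝕜 M, a x = a y) : x = y := by
  rw [← sum_coordL_smul (𝕜 := 𝕜) x, ← sum_coordL_smul (𝕜 := 𝕜) y]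
  simp_rw [h]

theorem bidualExt_inclusion (V : F →L[𝕜] M) (y : F) :
    bidualExt V (NormedSpace.inclusionInDoubleDual 𝕜 F y) = V y :=
  eq_of_forall_dual_eq (𝕜 := 𝕜) fun a => by rw [dual_bidualExt]; simp

theorem bidualExt_comp (P : M →L[𝕜] H) (V : F →L[𝕜] M) :
    bidualExt (P ∘L V) = P ∘L bidualExt V := by
  ext z
  refine eq_of_forall_dual_eq (𝕜 := 𝕜) fun a => ?_
  rw [dual_bidualExt, ContinuousLinearMap.comp_apply, ← ContinuousLinearMap.comp_apply a P,
    dual_bidualExt, ContinuousLinearMap.comp_assoc]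

end Trace

/-! ### Separation and the classical form of local reflexivity -/

section LocalReflexivity

variable {M F : Type u}
  [NormedAddCommGroup M] [NormedSpace 𝕜 M] [FiniteDimensional 𝕜 M]
  [NormedAddCommGroup F] [NormedSpace 𝕜 F]

/-- A functional vanishing on the pre-annihilator of a finite-dimensional subspace of the dual
belongs to this subspace. -/
theorem mem_of_forall_eq_zero (N : Submodule 𝕜 (StrongDual 𝕜 F)) [FiniteDimensional 𝕜 N]
    (ψ : StrongDual 𝕜 F) (h : ∀ y, (∀ b ∈ N, b y = 0) → ψ y = 0) : ψ ∈ N := by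
  let n : Fin (Module.finrank 𝕜 N) → StrongDual 𝕜 F := fun i => (Module.finBasis 𝕜 N i : N)
  have hmem : (ψ : F →ₗ[𝕜] 𝕜) ∈
      Submodule.span 𝕜 (Set.range fun i => (n i : F →ₗ[𝕜] 𝕜)) := by
    refine mem_span_of_iInf_ker_le_ker fun y hy => h y fun b hb => ?_
    have hb' := congrArg (fun z : N => (z : StrongDual 𝕜 F) y)
      ((Module.finBasis 𝕜 N).sum_repr ⟨b, hb⟩)
    simp only [Submodule.mem_iInf, LinearMap.mem_ker] at hy
    simp only [AddSubmonoidClass.coe_finsetSum, Submodule.coe_smul,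
      sum_apply, smul_apply] at hb'
    rw [← hb']
    exact Finset.sum_eq_zero fun i _ => by
      rw [show ((Module.finBasis 𝕜 N i : N) : StrongDual 𝕜 F) y = 0 from hy i, smul_zero]
  obtain ⟨c, hc⟩ := (Submodule.mem_span_range_iff_exists_fun 𝕜).1 hmem
  have : ψ = ∑ i, c i • n i := by
    ext y
    have := congrArg (fun z : F →ₗ[𝕜] 𝕜 => z y) hc
    simpa using this.symm
  rw [this]
  exact N.sum_mem fun i _ => N.smul_mem _ (Module.finBasis 𝕜 N i : N).2

/-- Helly's theorem without norms, in linear form: functionals on a finite-dimensional subspace of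
the dual are evaluations at vectors depending linearly on them. -/
theorem exists_linear_helly (N : Submodule 𝕜 (StrongDual 𝕜 F)) [FiniteDimensional 𝕜 N] :
    ∃ ρ : Module.Dual 𝕜 N →ₗ[𝕜] F, ∀ (a : Module.Dual 𝕜 N) (b : N),
      (b : StrongDual 𝕜 F) (ρ a) = a b := by
  let e : F →ₗ[𝕜] Module.Dual 𝕜 N :=
    LinearMap.flip ((ContinuousLinearMap.coeLM 𝕜 : (F →L[𝕜] 𝕜) →ₗ[𝕜] F →ₗ[𝕜] 𝕜) ∘ₗ N.subtype)
  -- The transpose of `e` is injective: functionals on the dual of `N` are evaluations at some `b`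
  -- in `N`, and `b` is zero once it kills all of `F`.
  have he : Function.Surjective e := by
    rw [← LinearMap.dualMap_injective_iff, injective_iff_map_eq_zero]
    intro θ hθ
    obtain ⟨b, rfl⟩ := (Module.evalEquiv 𝕜 N).surjective θ
    have hb : b = 0 := Subtype.ext <| ContinuousLinearMap.ext fun y =>
      congrArg (fun z : Module.Dual 𝕜 F => z y) hθ
    rw [hb, map_zero]
  obtain ⟨ρ, hρ⟩ := e.exists_rightInverse_of_surjective (LinearMap.range_eq_top.2 he)
  exact ⟨ρ, fun a b => congrArg (fun z : Module.Dual 𝕜 N →ₗ[𝕜] Module.Dual 𝕜 N => z a b) hρ⟩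

/-- Operators into the bidual may be replaced by operators into the space, up to finitely many
functionals and without changing the values in the space. -/
theorem exists_comp_eq_on (N : Submodule 𝕜 (StrongDual 𝕜 F)) [FiniteDimensional 𝕜 N]
    (T : M →L[𝕜] StrongDual 𝕜 (StrongDual 𝕜 F)) :
    ∃ S : M →L[𝕜] F, (∀ x, ∀ b ∈ N, b (S x) = T x b) ∧
      ∀ x, T x ∈ Set.range (NormedSpace.inclusionInDoubleDual 𝕜 F) →
        NormedSpace.inclusionInDoubleDual 𝕜 F (S x) = T x := by
  set j := NormedSpace.inclusionInDoubleDual 𝕜 F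
  have hj : Function.Injective (j : F →ₗ[𝕜] StrongDual 𝕜 (StrongDual 𝕜 F)) :=
    (NormedSpace.inclusionInDoubleDualLi 𝕜 (E := F)).injective
  obtain ⟨k, hk⟩ := LinearMap.exists_leftInverse_of_injective
    (j : F →ₗ[𝕜] StrongDual 𝕜 (StrongDual 𝕜 F)) (LinearMap.ker_eq_bot.2 hj)
  have hkj : ∀ y, k (j y) = y := fun y => congrArg (fun z : F →ₗ[𝕜] F => z y) hk
  obtain ⟨ρ, hρ⟩ := exists_linear_helly N
  let res : StrongDual 𝕜 (StrongDual 𝕜 F) →ₗ[𝕜] Module.Dual 𝕜 N :=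
    LinearMap.lcomp 𝕜 𝕜 N.subtype ∘ₗ ContinuousLinearMap.coeLM 𝕜
  have hres : ∀ z (b : N), res z b = z b := fun z b => rfl
  let T' : M →ₗ[𝕜] StrongDual 𝕜 (StrongDual 𝕜 F) := T
  -- An algebraic left inverse `k` of `j` gives the right values where `T x` lies in `F`; the `ρ`
  -- term repairs the pairing with `N` and vanishes there. Continuity is automatic on `M`.
  let S₀ : M →ₗ[𝕜] F :=
    k ∘ₗ T' + ρ ∘ₗ res ∘ₗ (T' - (j : F →ₗ[𝕜] StrongDual 𝕜 (StrongDual 𝕜 F)) ∘ₗ k ∘ₗ T')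
  have hS₀ : ∀ x, S₀ x = k (T x) + ρ (res (T x - j (k (T x)))) := fun x => rfl
  refine ⟨LinearMap.toContinuousLinearMap S₀, fun x b hb => ?_, fun x hx => ?_⟩
  · have h1 := hρ (res (T x - j (k (T x)))) ⟨b, hb⟩
    rw [LinearMap.coe_toContinuousLinearMap', hS₀, map_add, h1, hres]
    simp [j]
  · obtain ⟨y, hy⟩ := hx
    rw [LinearMap.coe_toContinuousLinearMap', hS₀, ← hy, hkj]
    simp

/-- Local reflexivity from an estimate on the trace functionals: if all the functionals
`S ↦ tr (V S)` dominated by the seminorm `p` on `L(M, F)` are bounded by `c` at `T : M → F''`, then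
operators `S : M → F` with `p S < c'` agree with `T` on prescribed functionals and wherever `T`
takes its values in `F`. -/
theorem exists_local_reflexive (p : Seminorm 𝕜 (M →L[𝕜] F)) {C : ℝ} (hp : ∀ S, p S ≤ C * ‖S‖)
    (N : Submodule 𝕜 (StrongDual 𝕜 F)) [FiniteDimensional 𝕜 N]
    (T : M →L[𝕜] StrongDual 𝕜 (StrongDual 𝕜 F)) {c c' : ℝ} (hc' : 0 < c') (hcc' : c < c')
    (hT : ∀ V : F →L[𝕜] M, (∀ S : M →L[𝕜] F, ‖opTrace (V ∘L S)‖ ≤ p S) →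
      ‖opTrace (bidualExt V ∘L T)‖ ≤ c) :
    ∃ S : M →L[𝕜] F, p S < c' ∧ (∀ x, ∀ b ∈ N, b (S x) = T x b) ∧
      ∀ x, T x ∈ Set.range (NormedSpace.inclusionInDoubleDual 𝕜 F) →
        NormedSpace.inclusionInDoubleDual 𝕜 F (S x) = T x := by
  set j := NormedSpace.inclusionInDoubleDual 𝕜 F
  obtain ⟨S₀, hS₀N, hS₀j⟩ := exists_comp_eq_on N T
  let M₀ : Submodule 𝕜 M := 
    (LinearMap.range (j : F →ₗ[𝕜] StrongDual 𝕜 (StrongDual 𝕜 F))).comap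
      (T : M →ₗ[𝕜] StrongDual 𝕜 (StrongDual 𝕜 F))
  let Y : Submodule 𝕜 (M →L[𝕜] F) :=
    { carrier := {S | (∀ x ∈ M₀, S x = 0) ∧ ∀ x, ∀ b ∈ N, b (S x) = 0}
      zero_mem' := ⟨fun _ _ => rfl, fun _ _ _ => by simp⟩
      add_mem' := fun {S S'} h h' =>
        ⟨fun x hx => by simp [h.1 x hx, h'.1 x hx], fun x b hb => by simp [h.2 x b hb, h'.2 x b hb]⟩
      smul_mem' := fun a S h =>
        ⟨fun x hx => by simp [h.1 x hx], fun x b hb => by simp [h.2 x b hb]⟩ }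
  by_cases hY : ∃ y ∈ Y, p (S₀ + y) < c'
  · obtain ⟨y, hy, hlt⟩ := hY
    refine ⟨S₀ + y, hlt, fun x b hb => ?_, fun x hx => ?_⟩
    · simp [hS₀N x b hb, hy.2 x b hb]
    · have : y x = 0 := hy.1 x hx
      simpa [this] using hS₀j x hx
  · exfalso
    push Not at hY
    obtain ⟨f, hfp, hfY, hf₀⟩ := p.exists_dual_of_forall_le Y S₀ hc' hY
    obtain ⟨V, hV⟩ := exists_opTrace_eq f fun S => (hfp S).trans (hp S)
    have hTV := hT V fun S => hV S ▸ hfp S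
    -- It remains to see `tr (V'' D) = 0` for the defect `D = T - j S₀`. As `D` vanishes on `M₀`, `D
    -- = D P` and the trace is that of `P V'' D`. Since `f` kills the rank one members of `Y`, every
    -- `a ∘ P ∘ V` lies in `N`, where the values of `D` vanish.
    obtain ⟨M₁, hM⟩ := Submodule.exists_isCompl M₀
    set P : M →L[𝕜] M := LinearMap.toContinuousLinearMap (M₁.projection M₀ hM.symm)
    have hP₀ : ∀ x ∈ M₀, P x = 0 := fun x hx =>
      (Submodule.projection_apply_eq_zero_iff hM.symm).2 hx
    have hP₁ : ∀ x, x - P x ∈ M₀ := fun x =>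
      Submodule.sub_projection_mem hM.symm x
    set D : M →L[𝕜] StrongDual 𝕜 (StrongDual 𝕜 F) := T - j ∘L S₀ with hD
    have hDP : D = D ∘L P := by
      ext1 x
      have h1 : D (x - P x) = 0 := sub_eq_zero.2 (hS₀j _ (hP₁ x)).symm
      rw [map_sub, sub_eq_zero] at h1
      exact h1
    have hPV : bidualExt (P ∘L V) ∘L D = 0 := by
      ext1 x
      refine eq_of_forall_dual_eq (𝕜 := 𝕜) fun a => ?_
      have hmem : a ∘L P ∘L V ∈ N := by
        refine mem_of_forall_eq_zero N _ fun y hy => ?_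
        have hYmem : ContinuousLinearMap.smulRight (a ∘L P) y ∈ Y :=
          ⟨fun x hx => by simp [hP₀ x hx], fun x b hb => by simp [hy b hb]⟩
        have h1 := hfY _ hYmem
        have h2 : V ∘L ContinuousLinearMap.smulRight (a ∘L P) y =
            ContinuousLinearMap.smulRight (a ∘L P) (V y) := by ext; simp
        rw [hV, h2, opTrace_smulRight] at h1
        exact h1
      rw [ContinuousLinearMap.comp_apply, dual_bidualExt]
      simp only [hD, sub_apply, ContinuousLinearMap.comp_apply,
        zero_apply, map_zero]
      rw [← hS₀N x _ hmem]
      simp [j]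
    have hDV : opTrace (bidualExt V ∘L D) = 0 := by
      rw [hDP, ← ContinuousLinearMap.comp_assoc, opTrace_comm, ← ContinuousLinearMap.comp_assoc,
        ← bidualExt_comp, hPV, map_zero]
    have hTD : bidualExt V ∘L T = V ∘L S₀ + bidualExt V ∘L D := by
      ext1 x
      simp [hD, j, bidualExt_inclusion]
    rw [hTD, map_add, hDV, add_zero, ← hV, hf₀, RCLike.norm_ofReal, abs_of_pos hc'] at hTV
    linarith

/-- The dual of a finite product with the supremum norm carries the sum norm. -/
theorem sum_norm_comp_single_le {ι : Type*} [Fintype ι] [DecidableEq ι] (g : (ι → F) →L[𝕜] 𝕜) :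
    ∑ i, ‖g ∘L ContinuousLinearMap.single 𝕜 (fun _ => F) i‖ ≤ ‖g‖ := by
  refine le_of_forall_pos_le_add fun ε hε => ?_
  -- The `+ 1` covers an empty index set. Below, almost norming vectors are rotated so that their
  -- `g`-values are nonnegative reals and add up without cancellation.
  set η : ℝ := ε / (Fintype.card ι + 1) with hη
  have hη0 : 0 < η := by positivity
  have key : ∀ i, ∃ y : F, ‖y‖ ≤ 1 ∧ ∃ r : ℝ,
      ‖g ∘L ContinuousLinearMap.single 𝕜 (fun _ => F) i‖ ≤ r + η ∧
      g (Pi.single i y) = (r : 𝕜) := fun i => by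
    obtain ⟨y, hy1, hy⟩ := ContinuousLinearMap.exists_lt_apply_of_lt_opNorm
      (g ∘L ContinuousLinearMap.single 𝕜 (fun _ => F) i) (sub_lt_self _ hη0)
    obtain ⟨u, hu, hu'⟩ := RCLike.exists_norm_eq_mul_self (g (Pi.single i y))
    refine ⟨u • y, by rw [norm_smul, hu, one_mul]; exact hy1.le, ‖g (Pi.single i y)‖, ?_, ?_⟩
    · exact (sub_lt_iff_lt_add.1 hy).le
    · rw [Pi.single_smul, map_smul, smul_eq_mul, hu']
  choose y hy r hr hgr using key
  have hsum : ((∑ i, r i : ℝ) : 𝕜) = g y := by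
    conv_rhs => rw [← Finset.univ_sum_single y, map_sum]
    simp [hgr]
  have hle : ∑ i, r i ≤ ‖g‖ := by
    calc ∑ i, r i ≤ ‖((∑ i, r i : ℝ) : 𝕜)‖ := by rw [RCLike.norm_ofReal]; exact le_abs_self _
      _ ≤ ‖g‖ * ‖y‖ := hsum ▸ g.le_opNorm y
      _ ≤ ‖g‖ * 1 := by
        gcongr
        exact (pi_norm_le_iff_of_nonneg zero_le_one).2 hy
      _ = ‖g‖ := mul_one _
  calc _ ≤ ∑ i, (r i + η) := Finset.sum_le_sum fun i _ => hr i
    _ = ∑ i, r i + Fintype.card ι * η := by simp [Finset.sum_add_distrib]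
    _ ≤ ‖g‖ + ε := by
      gcongr
      rw [hη, mul_div_assoc', div_le_iff₀ (by positivity)]
      nlinarith

/-- A weak form of the principle of local reflexivity for the operator norm. -/
theorem exists_weak_local_reflexive (N : Submodule 𝕜 (StrongDual 𝕜 F)) [FiniteDimensional 𝕜 N]
    (T : M →L[𝕜] StrongDual 𝕜 (StrongDual 𝕜 F)) (hT : ‖T‖ ≤ 1) {δ : ℝ} (hδ : 0 < δ) :
    ∃ S : M →L[𝕜] F, ‖S‖ ≤ 1 + δ ∧ ∀ x, ∀ b ∈ N, b (S x) = T x b := by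
  -- The maximum over an `r`-net of the unit ball controls `‖S‖` up to the factor `1 - r`, and `r`
  -- is tuned to turn `1 + δ / 2` into `1 + δ`.
  obtain ⟨r, hr, hr1⟩ : ∃ r : ℝ, 0 < r ∧ (1 + δ / 2) = (1 + δ) * (1 - r) := by
    refine ⟨δ / (2 * (1 + δ)), by positivity, ?_⟩
    field_simp
    ring
  have hrlt : 0 < 1 - r := by
    by_contra hcon
    nlinarith
  have : ProperSpace M := FiniteDimensional.proper 𝕜 M
  obtain ⟨t, htB, htfin, htcov⟩ :=
    (isCompact_closedBall (0 : M) 1).finite_cover_balls hr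
  have : Fintype t := htfin.fintype
  let Φ : (M →L[𝕜] F) →ₗ[𝕜] (t → F) := LinearMap.pi fun x =>
    (ContinuousLinearMap.apply 𝕜 F (x : M) : (M →L[𝕜] F) →ₗ[𝕜] F)
  have hΦ : ∀ S x, Φ S x = S x := fun S x => rfl
  have hx1 : ∀ x : t, ‖(x : M)‖ ≤ 1 := fun x => by simpa using htB x.2
  let p : Seminorm 𝕜 (M →L[𝕜] F) := (normSeminorm 𝕜 (t → F)).comp Φ
  have hpdef : ∀ S, p S = ‖Φ S‖ := fun S => rfl
  have hp : ∀ S, p S ≤ 1 * ‖S‖ := fun S => by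
    rw [hpdef, one_mul, pi_norm_le_iff_of_nonneg (norm_nonneg S)]
    exact fun x => (S.le_opNorm x).trans (mul_le_of_le_one_right (norm_nonneg S) (hx1 x))
  have hnorm : ∀ S : M →L[𝕜] F, ‖S‖ * (1 - r) ≤ p S := fun S => by
    have : ‖S‖ ≤ p S + ‖S‖ * r := by
      refine S.opNorm_le_of_unit_norm (by positivity) fun x hx => ?_
      obtain ⟨y, hy, hxy⟩ := Set.mem_iUnion₂.1 (htcov (show x ∈ Metric.closedBall 0 1 by simp [hx]))
      rw [Metric.mem_ball, dist_eq_norm] at hxy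
      calc ‖S x‖ = ‖Φ S ⟨y, hy⟩ + S (x - y)‖ := by rw [hΦ, map_sub, add_sub_cancel]
        _ ≤ p S + ‖S‖ * r := (norm_add_le _ _).trans
          (add_le_add (norm_le_pi_norm (Φ S) ⟨y, hy⟩) (S.le_opNorm_of_le hxy.le))
    linarith
  suffices h : ∀ V : F →L[𝕜] M, (∀ S : M →L[𝕜] F, ‖opTrace (V ∘L S)‖ ≤ p S) →
      ‖opTrace (bidualExt V ∘L T)‖ ≤ 1 by
    obtain ⟨S, hS, hSN, -⟩ := exists_local_reflexive p hp N T (c' := 1 + δ / 2)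
      (by positivity) (by linarith) h
    exact ⟨S, by nlinarith [hnorm S], hSN⟩
  intro V hV
  let f : Module.Dual 𝕜 (M →L[𝕜] F) :=
    opTrace ∘ₗ ((ContinuousLinearMap.compL 𝕜 M F M V : _ →L[𝕜] _) : (M →L[𝕜] F) →ₗ[𝕜] M →L[𝕜] M)
  have hf : ∀ S, f S = opTrace (V ∘L S) := fun S => rfl
  -- Being dominated by `‖Φ S‖`, `f` factors through the range of `Φ` and extends to `t → F`. Its
  -- components `φ x` have norms summing to at most `1`, and `V` becomes the sum of the rank one
  -- operators `y ↦ φ x y • x`.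
  obtain ⟨s, hs⟩ := Φ.rangeRestrict.exists_rightInverse_of_surjective Φ.range_rangeRestrict
  have hs' : ∀ z, Φ (s z) = z := fun z =>
    congrArg (fun w : LinearMap.range Φ →ₗ[𝕜] LinearMap.range Φ => ((w z : _) : t → F)) hs
  have hfs : ∀ z, ‖(f ∘ₗ s) z‖ ≤ 1 * ‖z‖ := fun z => by
    rw [one_mul]
    refine (hV (s z)).trans_eq ?_
    rw [hpdef, hs', Submodule.coe_norm]
  obtain ⟨g, hg, hgn⟩ := exists_extension_norm_eq (LinearMap.range Φ) ((f ∘ₗ s).mkContinuous 1 hfs)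
  have hg1 : ‖g‖ ≤ 1 := hgn ▸ LinearMap.mkContinuous_norm_le _ zero_le_one _
  have hgΦ : ∀ S, g (Φ S) = f S := fun S => by
    have h1 := hg ⟨Φ S, S, rfl⟩
    have h2 : f (s ⟨Φ S, S, rfl⟩ - S) = 0 := by
      rw [← norm_le_zero_iff]
      refine (hV _).trans_eq ?_
      rw [hpdef, map_sub, hs', sub_self, norm_zero]
    rw [map_sub, sub_eq_zero] at h2
    exact h1.trans h2
  classical
  let φ : t → StrongDual 𝕜 F := fun x => g ∘L ContinuousLinearMap.single 𝕜 (fun _ => F) x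
  have hgφ : ∀ w, g w = ∑ x, φ x (w x) := fun w => by
    conv_lhs => rw [← Finset.univ_sum_single w, map_sum]
    rfl
  have hφ : ∀ a : StrongDual 𝕜 M, a ∘L V = ∑ x : t, a x • φ x := fun a => by
    ext y
    have h1 : V ∘L ContinuousLinearMap.smulRight a y = ContinuousLinearMap.smulRight a (V y) := by
      ext; simp
    have h2 := hgΦ (ContinuousLinearMap.smulRight a y)
    rw [hf, h1, opTrace_smulRight, hgφ] at h2
    simpa [hΦ] using h2.symm
  have hVT : bidualExt V ∘L T =
      ∑ x : t, ContinuousLinearMap.smulRight (ContinuousLinearMap.apply 𝕜 𝕜 (φ x) ∘L T) (x : M) := by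
    ext1 m
    refine eq_of_forall_dual_eq (𝕜 := 𝕜) fun a => ?_
    rw [ContinuousLinearMap.comp_apply, dual_bidualExt, hφ]
    simp [mul_comm]
  rw [hVT, map_sum]
  simp only [opTrace_smulRight, ContinuousLinearMap.comp_apply, ContinuousLinearMap.apply_apply]
  refine (norm_sum_le _ _).trans (le_trans (Finset.sum_le_sum fun x _ => ?_)
    ((sum_norm_comp_single_le g).trans hg1))
  calc ‖T x (φ x)‖ ≤ ‖T x‖ * ‖φ x‖ := (T x).le_opNorm _
    _ ≤ 1 * ‖φ x‖ := by
      gcongr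
      exact (T.le_opNorm_of_le (hx1 x)).trans (by simpa using hT)
    _ = _ := one_mul _

end LocalReflexivity

/-! ### Embedding into `ℓ∞` and its metric approximation property -/

section SupNorm

open scoped ENNReal

/-- The canonical isometric embedding of a normed space into a space of bounded functions. -/
def supEmbedding (𝕜 : Type) [RCLike 𝕜] (F : Type u) [NormedAddCommGroup F] [NormedSpace 𝕜 F] :
    F →ₗᵢ[𝕜] lp (fun _ : Metric.closedBall (0 : StrongDual 𝕜 F) 1 => 𝕜) ∞ where
  toFun y := ⟨fun φ => (φ : StrongDual 𝕜 F) y, memℓp_infty ⟨‖y‖, by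
    rintro _ ⟨φ, rfl⟩
    simpa using (φ : StrongDual 𝕜 F).le_of_opNorm_le (mem_closedBall_zero_iff.1 φ.2) y⟩⟩
  map_add' y z := by ext φ; exact map_add (φ : StrongDual 𝕜 F) y z
  map_smul' c y := by ext φ; exact map_smul (φ : StrongDual 𝕜 F) c y
  norm_map' y := by
    refine le_antisymm (lp.norm_le_of_forall_le (norm_nonneg y) fun φ => ?_) ?_
    · simpa using (φ : StrongDual 𝕜 F).le_of_opNorm_le (mem_closedBall_zero_iff.1 φ.2) y
    · obtain ⟨g, hg, hgy⟩ := exists_dual_vector'' 𝕜 y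
      set z : lp (fun _ : Metric.closedBall (0 : StrongDual 𝕜 F) 1 => 𝕜) ∞ := _
      change ‖y‖ ≤ ‖z‖
      have h := lp.norm_apply_le_norm ENNReal.top_ne_zero z ⟨g, mem_closedBall_zero_iff.2 hg⟩
      have h1 : z ⟨g, mem_closedBall_zero_iff.2 hg⟩ = (‖y‖ : 𝕜) := hgy
      rwa [h1, RCLike.norm_ofReal, abs_norm] at h

/-- The metric approximation property of spaces of bounded functions. -/
theorem exists_finiteRank_approx {Γ M : Type u} [NormedAddCommGroup M] [NormedSpace 𝕜 M]
    [FiniteDimensional 𝕜 M] (S : M →L[𝕜] lp (fun _ : Γ => 𝕜) ∞) {δ : ℝ} (hδ : 0 < δ) :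
    ∃ P : lp (fun _ : Γ => 𝕜) ∞ →L[𝕜] lp (fun _ : Γ => 𝕜) ∞,
      FiniteRank P ∧ ‖P‖ ≤ 1 ∧ ‖S - P ∘L S‖ ≤ δ := by
  have : FiniteDimensional 𝕜 (StrongDual 𝕜 M) := inferInstance
  have : ProperSpace (StrongDual 𝕜 M) := FiniteDimensional.proper 𝕜 _
  have hbound : ∀ γ x, ‖S x γ‖ ≤ ‖S‖ * ‖x‖ := fun γ x =>
    (lp.norm_apply_le_norm ENNReal.top_ne_zero (S x) γ).trans (S.le_opNorm x)
  -- The coordinates of `S` form a totally bounded set in the dual of `M`, so `Γ` splits into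
  -- finitely many cells on which they nearly agree; `P` replaces each coordinate by that of a
  -- representative of its cell.
  let v : Γ → StrongDual 𝕜 M := fun γ => LinearMap.mkContinuous
    { toFun := fun x => S x γ
      map_add' := fun x y => by simp
      map_smul' := fun c x => by simp } ‖S‖ (hbound γ)
  have htb : TotallyBounded (Set.range v) :=
    ((isCompact_closedBall (0 : StrongDual 𝕜 M) ‖S‖).totallyBounded).subset <| by
      rintro _ ⟨γ, rfl⟩
      rw [mem_closedBall_zero_iff]
      exact LinearMap.mkContinuous_norm_le _ (norm_nonneg S) _
  obtain ⟨t, htv, htfin, hcov⟩ := Metric.finite_approx_of_totallyBounded htb δ hδ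
  have : Fintype t := htfin.fintype
  have hσ : ∀ y : t, ∃ γ, v γ = y := fun y => htv y.2
  have hq : ∀ γ, ∃ y : t, dist (v γ) y < δ := fun γ => by
    obtain ⟨y, hy, hd⟩ := Set.mem_iUnion₂.1 (hcov ⟨γ, rfl⟩)
    exact ⟨⟨y, hy⟩, hd⟩
  choose σ hσ using hσ
  choose q hq using hq
  let E : (t → 𝕜) →ₗ[𝕜] lp (fun _ : Γ => 𝕜) ∞ :=
    { toFun := fun e => ⟨fun γ => e (q γ), memℓp_infty ⟨‖e‖, by
        rintro _ ⟨γ, rfl⟩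
        exact norm_le_pi_norm e (q γ)⟩⟩
      map_add' := fun e e' => by ext γ; rfl
      map_smul' := fun c e => by ext γ; rfl }
  let R : lp (fun _ : Γ => 𝕜) ∞ →ₗ[𝕜] (t → 𝕜) :=
    { toFun := fun f y => f (σ y)
      map_add' := fun f g => by ext y; simp
      map_smul' := fun c f => by ext y; simp }
  let P : lp (fun _ : Γ => 𝕜) ∞ →L[𝕜] lp (fun _ : Γ => 𝕜) ∞ :=
    LinearMap.mkContinuous (E ∘ₗ R) 1 fun f => by
      rw [one_mul]
      refine lp.norm_le_of_forall_le (norm_nonneg f) fun γ => ?_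
      exact lp.norm_apply_le_norm ENNReal.top_ne_zero f _
  refine ⟨P, ?_, LinearMap.mkContinuous_norm_le _ zero_le_one _, ?_⟩
  · exact Submodule.finiteDimensional_of_le (LinearMap.range_comp_le_range R E)
  · refine ContinuousLinearMap.opNorm_le_bound _ hδ.le fun x => ?_
    refine lp.norm_le_of_forall_le (by positivity) fun γ => ?_
    have h1 : ((S - P ∘L S) x : Γ → 𝕜) γ = (v γ - v (σ (q γ))) x := rfl
    rw [h1]
    refine ContinuousLinearMap.le_of_opNorm_le _ ?_ x
    rw [hσ, ← dist_eq_norm]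
    exact (hq γ).le

end SupNorm

/-! ### Adjoint norms -/

namespace OpClass

theorem adjoint_norm_nonneg (A : OpClass.{u} 𝕜) {E F : Type u}
    [NormedAddCommGroup E] [NormedSpace 𝕜 E] [CompleteSpace E]
    [NormedAddCommGroup F] [NormedSpace 𝕜 F] [CompleteSpace F] (T : E →L[𝕜] F) :
    0 ≤ A.adjoint.norm T :=
  Real.sInf_nonneg fun _ hc => hc.1

theorem adjoint_norm_le {A : OpClass.{u} 𝕜} {E F : Type u}
    [NormedAddCommGroup E] [NormedSpace 𝕜 E] [CompleteSpace E]
    [NormedAddCommGroup F] [NormedSpace 𝕜 F] [CompleteSpace F] {T : E →L[𝕜] F} {c : ℝ}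
    (hc : c ∈ A.adjointConstants T) : A.adjoint.norm T ≤ c :=
  csInf_le ⟨0, fun _ h => h.1⟩ hc

/-- The infimum in the definition of the adjoint norm is attained. -/
theorem norm_finTrace_le {A : OpClass.{u} 𝕜} {E F E₀ F₀ : Type u}
    [NormedAddCommGroup E] [NormedSpace 𝕜 E] [CompleteSpace E]
    [NormedAddCommGroup F] [NormedSpace 𝕜 F] [CompleteSpace F]
    [NormedAddCommGroup E₀] [NormedSpace 𝕜 E₀] [CompleteSpace E₀]
    [NormedAddCommGroup F₀] [NormedSpace 𝕜 F₀] [CompleteSpace F₀]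
    {T : E →L[𝕜] F} (hT : A.adjoint.mem T)
    (B : E₀ →L[𝕜] E) (S : F₀ →L[𝕜] E₀) (R : F →L[𝕜] F₀)
    (hB : FiniteRank B) (hS : A.mem S) (hR : FiniteRank R) (hS₀ : 0 ≤ A.norm S) :
    ‖finTrace (T ∘L B ∘L S ∘L R)‖ ≤ A.adjoint.norm T * ‖B‖ * A.norm S * ‖R‖ := by
  have hd : 0 ≤ ‖B‖ * A.norm S * ‖R‖ := by positivity
  have h : ∀ c ∈ A.adjointConstants T,
      ‖finTrace (T ∘L B ∘L S ∘L R)‖ ≤ c * (‖B‖ * A.norm S * ‖R‖) := fun c hc =>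
    (hc.2 E₀ F₀ B S R hB hS hR).trans_eq (by ring)
  have key : ‖finTrace (T ∘L B ∘L S ∘L R)‖ ≤ A.adjoint.norm T * (‖B‖ * A.norm S * ‖R‖) := by
    rcases hd.eq_or_lt with h0 | h0
    · obtain ⟨c, hc⟩ := hT
      have := h c hc
      rw [← h0, mul_zero] at this ⊢
      exact this
    · rw [← div_le_iff₀ h0]
      exact le_csInf hT fun c hc => (div_le_iff₀ h0).2 (h c hc)
  exact key.trans_eq (by ring)

/-- Every class is contained in its second adjoint, with constant `A.norm T` at `T`. -/
theorem norm_mem_adjointConstants_adjoint {A : OpClass.{u} 𝕜} {E F : Type u}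
    [NormedAddCommGroup E] [NormedSpace 𝕜 E] [CompleteSpace E]
    [NormedAddCommGroup F] [NormedSpace 𝕜 F] [CompleteSpace F]
    {T : E →L[𝕜] F} (hT : A.mem T) (hT₀ : 0 ≤ A.norm T) :
    A.norm T ∈ A.adjoint.adjointConstants T := by
  refine ⟨hT₀, fun E₀ F₀ _ _ _ _ _ _ B S R hB hS hR => ?_⟩
  have h1 : finTrace (T ∘L B ∘L S ∘L R) = finTrace (S ∘L R ∘L T ∘L B) :=
    finTrace_comp_comm (T ∘L B) (S ∘L R) (hB.comp_left T)
  rw [h1]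
  exact (norm_finTrace_le hS R T B hR hT hB hT₀).trans_eq (by ring)

/-- The third adjoint norm is the first one. -/
theorem adjoint_norm_le_adjoint_adjoint_adjoint {A : OpClass.{u} 𝕜}
    (hA : ∀ {E F : Type u} [NormedAddCommGroup E] [NormedSpace 𝕜 E] [CompleteSpace E]
      [NormedAddCommGroup F] [NormedSpace 𝕜 F] [CompleteSpace F] (T : E →L[𝕜] F),
      A.mem T → 0 ≤ A.norm T) {E F : Type u}
    [NormedAddCommGroup E] [NormedSpace 𝕜 E] [CompleteSpace E]
    [NormedAddCommGroup F] [NormedSpace 𝕜 F] [CompleteSpace F]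
    {T : E →L[𝕜] F} (hT : A.adjoint.mem T) :
    A.adjoint.norm T ≤ A.adjoint.adjoint.adjoint.norm T := by
  -- Needed because the infimum of the empty set is `0`. The inequality then holds because operators
  -- in `A` lie in `A**` with no larger norm, so `A**` provides more tests than `A`.
  have hne : A.adjoint.adjoint.adjoint.mem T :=
    ⟨_, norm_mem_adjointConstants_adjoint hT (A.adjoint_norm_nonneg T)⟩
  refine csInf_le_csInf ⟨0, fun _ h => h.1⟩ hne fun c hc => ⟨hc.1, ?_⟩
  intro E₀ F₀ _ _ _ _ _ _ B S R hB hS hR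
  have hS' := norm_mem_adjointConstants_adjoint hS (hA S hS)
  refine (hc.2 E₀ F₀ B S R hB ⟨_, hS'⟩ hR).trans ?_
  have := hc.1
  gcongr
  exact adjoint_norm_le hS'

/-! ### Banach ideals on finite-dimensional spaces -/

section Ideal

variable {A : OpClass.{u} 𝕜} {M H E F G : Type u}
  [NormedAddCommGroup M] [NormedSpace 𝕜 M] [CompleteSpace M] [FiniteDimensional 𝕜 M]
  [NormedAddCommGroup E] [NormedSpace 𝕜 E] [CompleteSpace E]
  [NormedAddCommGroup F] [NormedSpace 𝕜 F] [CompleteSpace F]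
  [NormedAddCommGroup G] [NormedSpace 𝕜 G] [CompleteSpace G]

namespace IsBanachIdeal

theorem zero_mem (hA : A.IsBanachIdeal) : A.mem (0 : E →L[𝕜] F) := by
  simpa using hA.rankOne_mem (0 : StrongDual 𝕜 E) (0 : F)

theorem norm_zero (hA : A.IsBanachIdeal) : A.norm (0 : E →L[𝕜] F) = 0 := by
  simpa using hA.norm_rankOne (0 : StrongDual 𝕜 E) (0 : F)

/-- Not an axiom, but `0 = A(S - S) ≤ 2 A(S)`. -/
theorem norm_nonneg (hA : A.IsBanachIdeal) {S : E →L[𝕜] F} (hS : A.mem S) : 0 ≤ A.norm S := by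
  have h1 := hA.norm_add_le S ((-1 : 𝕜) • S) hS (hA.smul_mem _ _ hS)
  rw [hA.norm_smul _ _ hS] at h1
  simp only [neg_smul, one_smul, add_neg_cancel, hA.norm_zero, norm_neg, norm_one, one_mul] at h1
  linarith

theorem norm_comp_right_le (hA : A.IsBanachIdeal) {S : F →L[𝕜] G} (hS : A.mem S)
    (T : E →L[𝕜] F) : A.norm (S ∘L T) ≤ A.norm S * ‖T‖ := by
  have h0 := hA.norm_nonneg hS
  calc A.norm (S ∘L T) ≤ ‖ContinuousLinearMap.id 𝕜 G‖ * A.norm S * ‖T‖ :=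
      hA.norm_comp_le (ContinuousLinearMap.id 𝕜 G) S T hS
    _ ≤ 1 * A.norm S * ‖T‖ := by
      gcongr
      exact ContinuousLinearMap.norm_id_le
    _ = _ := by rw [one_mul]

theorem norm_comp_left_le (hA : A.IsBanachIdeal) {S : E →L[𝕜] F} (hS : A.mem S)
    (R : F →L[𝕜] G) : A.norm (R ∘L S) ≤ ‖R‖ * A.norm S := by
  have h0 := hA.norm_nonneg hS
  calc A.norm (R ∘L S) ≤ ‖R‖ * A.norm S * ‖ContinuousLinearMap.id 𝕜 E‖ :=
      hA.norm_comp_le R S (ContinuousLinearMap.id 𝕜 E) hS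
    _ ≤ ‖R‖ * A.norm S * 1 := by
      gcongr
      exact ContinuousLinearMap.norm_id_le
    _ = _ := by rw [mul_one]

/-- Composing `S` with a rank one operator whose functional has norm one gives a rank one operator,
on which the norm is prescribed. -/
theorem opNorm_le (hA : A.IsBanachIdeal) {S : E →L[𝕜] F} (hS : A.mem S) : ‖S‖ ≤ A.norm S := by
  refine S.opNorm_le_bound (hA.norm_nonneg hS) fun x => ?_
  by_cases hx : ‖x‖ = 0
  · rw [norm_eq_zero] at hx
    simp [hx]
  obtain ⟨a, ha, -⟩ := exists_dual_vector 𝕜 x hx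
  have h1 := hA.norm_comp_right_le hS (ContinuousLinearMap.smulRight a x)
  have h2 : S ∘L ContinuousLinearMap.smulRight a x = ContinuousLinearMap.smulRight a (S x) := by
    ext; simp
  rw [h2, hA.norm_rankOne, ha, one_mul, ContinuousLinearMap.norm_smulRight_apply, ha,
    one_mul] at h1
  exact h1

theorem sum_mem_and_norm_le (hA : A.IsBanachIdeal) {ι : Type*} (s : Finset ι)
    (S : ι → E →L[𝕜] F) (hS : ∀ i ∈ s, A.mem (S i)) :
    A.mem (∑ i ∈ s, S i) ∧ A.norm (∑ i ∈ s, S i) ≤ ∑ i ∈ s, A.norm (S i) := by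
  classical
  induction s using Finset.induction_on with
  | empty => exact ⟨by simpa using hA.zero_mem, by simp [hA.norm_zero]⟩
  | insert i s hi ih =>
    obtain ⟨h1, h2⟩ := ih fun k hk => hS k (Finset.mem_insert_of_mem hk)
    have h3 := hS i (Finset.mem_insert_self i s)
    rw [Finset.sum_insert hi, Finset.sum_insert hi]
    exact ⟨hA.add_mem _ _ h3 h1, (hA.norm_add_le _ _ h3 h1).trans (by gcongr)⟩

/-- Operators with finite-dimensional codomain belong to every ideal. -/
theorem mem_of_range (hA : A.IsBanachIdeal) (V : F →L[𝕜] M) : A.mem V := by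
  rw [eq_sum_smulRight_of_range V]
  exact (hA.sum_mem_and_norm_le _ _ fun i _ => hA.rankOne_mem _ _).1

theorem exists_norm_le_of_range (hA : A.IsBanachIdeal) (M F : Type u)
    [NormedAddCommGroup M] [NormedSpace 𝕜 M] [CompleteSpace M] [FiniteDimensional 𝕜 M]
    [NormedAddCommGroup F] [NormedSpace 𝕜 F] [CompleteSpace F] :
    ∃ C : ℝ, ∀ V : F →L[𝕜] M, A.norm V ≤ C * ‖V‖ := by
  refine ⟨∑ i, ‖coordL 𝕜 M i‖ * ‖Module.finBasis 𝕜 M i‖, fun V => ?_⟩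
  conv_lhs => rw [eq_sum_smulRight_of_range V]
  refine (hA.sum_mem_and_norm_le _ _ fun i _ => hA.rankOne_mem _ _).2.trans ?_
  rw [Finset.sum_mul]
  refine Finset.sum_le_sum fun i _ => ?_
  rw [hA.norm_rankOne, mul_right_comm]
  gcongr
  exact ContinuousLinearMap.opNorm_comp_le _ _

/-- The ideal norm, as a seminorm on operators with finite-dimensional codomain. -/
def seminormOfRange (hA : A.IsBanachIdeal) (M F : Type u)
    [NormedAddCommGroup M] [NormedSpace 𝕜 M] [CompleteSpace M] [FiniteDimensional 𝕜 M]
    [NormedAddCommGroup F] [NormedSpace 𝕜 F] [CompleteSpace F] : Seminorm 𝕜 (F →L[𝕜] M) :=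
  Seminorm.of (fun V => A.norm V)
    (fun V W => hA.norm_add_le V W (hA.mem_of_range V) (hA.mem_of_range W))
    (fun c V => hA.norm_smul c V (hA.mem_of_range V))

/-- A crude bound from continuity of the trace on `M`; it makes `A*` finite and continuous there, as
Hahn–Banach requires. -/
theorem exists_mul_mem_adjointConstants (hA : A.IsBanachIdeal) (M F : Type u)
    [NormedAddCommGroup M] [NormedSpace 𝕜 M] [CompleteSpace M] [FiniteDimensional 𝕜 M]
    [NormedAddCommGroup F] [NormedSpace 𝕜 F] [CompleteSpace F] :
    ∃ C : ℝ, ∀ S : M →L[𝕜] F, C * ‖S‖ ∈ A.adjointConstants S := by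
  obtain ⟨C, hC0, hC⟩ := exists_norm_opTrace_le 𝕜 M
  refine ⟨C, fun S => ⟨by positivity, fun E₀ F₀ _ _ _ _ _ _ B S' R _ hS' _ => ?_⟩⟩
  rw [finTrace_comp_eq_opTrace]
  have hn := hA.opNorm_le hS'
  calc ‖opTrace ((B ∘L S' ∘L R) ∘L S)‖ ≤ C * ‖(B ∘L S' ∘L R) ∘L S‖ := hC _
    _ ≤ C * (‖B‖ * (‖S'‖ * ‖R‖) * ‖S‖) := by
      gcongr
      refine (ContinuousLinearMap.opNorm_comp_le _ _).trans ?_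
      gcongr
      refine (ContinuousLinearMap.opNorm_comp_le _ _).trans ?_
      gcongr
      exact ContinuousLinearMap.opNorm_comp_le _ _
    _ ≤ C * (‖B‖ * (A.norm S' * ‖R‖) * ‖S‖) := by gcongr
    _ = C * ‖S‖ * ‖B‖ * A.norm S' * ‖R‖ := by ring

theorem adjoint_mem_of_domain (hA : A.IsBanachIdeal) (S : M →L[𝕜] F) : A.adjoint.mem S := by
  obtain ⟨C, hC⟩ := hA.exists_mul_mem_adjointConstants M F
  exact ⟨_, hC S⟩

/-- The adjoint norm, as a seminorm on operators with finite-dimensional domain. -/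
def adjointSeminorm (hA : A.IsBanachIdeal) (M F : Type u)
    [NormedAddCommGroup M] [NormedSpace 𝕜 M] [CompleteSpace M] [FiniteDimensional 𝕜 M]
    [NormedAddCommGroup F] [NormedSpace 𝕜 F] [CompleteSpace F] : Seminorm 𝕜 (M →L[𝕜] F) :=
  Seminorm.ofSMulLE (fun S => A.adjoint.norm S)
    (by
      obtain ⟨C, hC⟩ := hA.exists_mul_mem_adjointConstants M F
      refine le_antisymm ((adjoint_norm_le (hC 0)).trans_eq ?_) (A.adjoint_norm_nonneg _)
      rw [_root_.norm_zero, mul_zero])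
    (fun S S' => by
      refine adjoint_norm_le ⟨add_nonneg (A.adjoint_norm_nonneg S) (A.adjoint_norm_nonneg S'),
        fun E₀ F₀ _ _ _ _ _ _ B W R hB hW hR => ?_⟩
      have h1 := norm_finTrace_le (hA.adjoint_mem_of_domain S) B W R hB hW hR (hA.norm_nonneg hW)
      have h2 := norm_finTrace_le (hA.adjoint_mem_of_domain S') B W R hB hW hR (hA.norm_nonneg hW)
      rw [finTrace_comp_eq_opTrace] at h1 h2 ⊢
      rw [ContinuousLinearMap.comp_add, map_add]
      refine (_root_.norm_add_le _ _).trans ((add_le_add h1 h2).trans_eq (by ring)))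
    (fun c S => by
      refine adjoint_norm_le ⟨mul_nonneg (_root_.norm_nonneg c) (A.adjoint_norm_nonneg S),
        fun E₀ F₀ _ _ _ _ _ _ B W R hB hW hR => ?_⟩
      have h1 := norm_finTrace_le (hA.adjoint_mem_of_domain S) B W R hB hW hR (hA.norm_nonneg hW)
      rw [finTrace_comp_eq_opTrace] at h1 ⊢
      rw [ContinuousLinearMap.comp_smul, map_smul, _root_.norm_smul]
      refine (mul_le_mul_of_nonneg_left h1 (_root_.norm_nonneg c)).trans_eq (by ring))

end IsBanachIdeal

/-! ### Trace duality and the main argument -/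

/-- Trace duality between `A` and its adjoint for operators on a finite-dimensional space: the
extension property makes `A` accessible. -/
theorem norm_opTrace_comp_le (hA : A.IsBanachIdeal) (hEP : A.HasExtensionProperty)
    (T : M →L[𝕜] F) (U : F →L[𝕜] M) :
    ‖opTrace (U ∘L T)‖ ≤ A.adjoint.norm T * A.norm U := by
  obtain ⟨C, hC0, hC⟩ := exists_norm_opTrace_le 𝕜 M
  have ha := A.adjoint_norm_nonneg T
  have hU := hA.norm_nonneg (hA.mem_of_range U)
  suffices h : ∀ ε > 0, ‖opTrace (U ∘L T)‖ ≤ A.adjoint.norm T * ((1 + ε) * A.norm U) by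
    refine le_of_forall_pos_le_add fun ε hε => ?_
    refine (h (ε / (A.adjoint.norm T * A.norm U + 1)) (by positivity)).trans ?_
    have : ε / (A.adjoint.norm T * A.norm U + 1) * (A.adjoint.norm T * A.norm U) ≤ ε := by
      rw [div_mul_eq_mul_div, div_le_iff₀ (by positivity)]
      nlinarith
    linarith
  intro ε hε
  -- The identity of `F` is not an admissible finite rank test. Instead `U = W J`, and `J` is
  -- replaced by the finite rank `P J`, which costs little since `P` is almost the identity on the
  -- range of `J T`.
  set J := supEmbedding 𝕜 F
  obtain ⟨W, hW, hUW, hWn⟩ := hEP ε hε _ _ _ J U (hA.mem_of_range U)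
  refine le_of_forall_pos_le_add fun η hη => ?_
  have hδ : 0 < η / (C * ‖W‖ + 1) := by positivity
  obtain ⟨P, hPfin, hPn, hPδ⟩ := exists_finiteRank_approx (J.toContinuousLinearMap ∘L T) hδ
  have hdec : U ∘L T = (ContinuousLinearMap.id 𝕜 M ∘L W ∘L P ∘L J.toContinuousLinearMap) ∘L T +
      W ∘L (J.toContinuousLinearMap ∘L T - P ∘L J.toContinuousLinearMap ∘L T) := by
    rw [hUW]
    ext x
    simp
  have h1 := norm_finTrace_le (hA.adjoint_mem_of_domain T) (ContinuousLinearMap.id 𝕜 M) W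
    (P ∘L J.toContinuousLinearMap) (finiteRank_of_range _) hW (hPfin.comp_right _)
    (hA.norm_nonneg hW)
  rw [finTrace_comp_eq_opTrace] at h1
  have hPJ : ‖P ∘L J.toContinuousLinearMap‖ ≤ 1 :=
    (ContinuousLinearMap.opNorm_comp_le _ _).trans
      (mul_le_one₀ hPn (norm_nonneg _) J.norm_toContinuousLinearMap_le)
  have hWn0 := hA.norm_nonneg hW
  rw [hdec, map_add]
  refine (norm_add_le _ _).trans (add_le_add (h1.trans ?_) ((hC _).trans ?_))
  · calc _ ≤ A.adjoint.norm T * 1 * ((1 + ε) * A.norm U) * 1 := by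
          gcongr
          exact ContinuousLinearMap.norm_id_le
      _ = _ := by ring
  · calc _ ≤ C * (‖W‖ * (η / (C * ‖W‖ + 1))) := by
          gcongr
          exact (ContinuousLinearMap.opNorm_comp_le _ _).trans (by gcongr)
      _ ≤ η := by
          rw [← mul_assoc, mul_div_assoc', div_le_iff₀ (by positivity)]
          nlinarith

/-- Trace duality between `A` and its adjoint for operators into the bidual. -/
theorem norm_opTrace_bidualExt_comp_le (hA : A.IsBanachIdeal) (hEP : A.HasExtensionProperty)
    (T : M →L[𝕜] StrongDual 𝕜 (StrongDual 𝕜 F)) (U : F →L[𝕜] M) :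
    ‖opTrace (bidualExt U ∘L T)‖ ≤ A.adjoint.norm T * A.norm U := by
  have ha := A.adjoint_norm_nonneg T
  have hU := hA.norm_nonneg (hA.mem_of_range U)
  obtain ⟨T₀, hT₀, -⟩ := (finiteRank_of_domain T).exists_factorization
  set H := LinearMap.range (T : M →ₗ[𝕜] StrongDual 𝕜 (StrongDual 𝕜 F))
  have : CompleteSpace H := FiniteDimensional.complete 𝕜 H
  let N : Submodule 𝕜 (StrongDual 𝕜 F) := Submodule.span 𝕜 (Set.range fun i => coordL 𝕜 M i ∘L U)
  have : FiniteDimensional 𝕜 N := FiniteDimensional.span_of_finite 𝕜 (Set.finite_range _)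
  have h : ∀ ε > 0, ‖opTrace (bidualExt U ∘L T)‖ ≤
      A.adjoint.norm T * ((1 + ε) * (A.norm U * (1 + ε))) := fun ε hε => by
    -- As `N` contains the coordinates of `U`, `U L` agrees with `U''` on the range `H` of `T`.
    -- Extending `U L` from `H` to `F''` gives `W` with `W T = U'' T` and controlled `A`-norm.
    obtain ⟨L, hL, hLN⟩ := exists_weak_local_reflexive N H.subtypeL H.norm_subtypeL_le hε
    obtain ⟨W, hW, hUW, hWn⟩ := hEP ε hε _ _ _ H.subtypeₗᵢ (U ∘L L) (hA.mem_of_range _)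
    have hUL : U ∘L L = bidualExt U ∘L H.subtypeL := by
      ext1 z
      rw [ContinuousLinearMap.comp_apply, ContinuousLinearMap.comp_apply, bidualExt_apply,
        ← sum_coordL_smul (𝕜 := 𝕜) (U (L z))]
      refine Finset.sum_congr rfl fun i _ => ?_
      rw [← hLN z _ (Submodule.subset_span ⟨i, rfl⟩)]
      rfl
    have hWT : bidualExt U ∘L T = W ∘L T := by
      have : bidualExt U ∘L H.subtypeL = W ∘L H.subtypeL := by
        rw [← hUL, hUW]
        rfl
      rw [hT₀, ← ContinuousLinearMap.comp_assoc, this, ContinuousLinearMap.comp_assoc]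
    rw [hWT]
    refine (norm_opTrace_comp_le hA hEP T W).trans ?_
    gcongr
    refine hWn.trans ?_
    gcongr
    refine (hA.norm_comp_right_le (hA.mem_of_range U) L).trans ?_
    gcongr
  have hlim : Tendsto (fun ε : ℝ => A.adjoint.norm T * ((1 + ε) * (A.norm U * (1 + ε))))
      (𝓝[>] 0) (𝓝 (A.adjoint.norm T * ((1 + 0) * (A.norm U * (1 + 0))))) := by
    refine Tendsto.mono_left (Continuous.tendsto ?_ 0) nhdsWithin_le_nhds
    fun_prop
  have := ge_of_tendsto hlim (eventually_mem_nhdsWithin.mono fun ε hε => h ε hε)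
  simpa using this

/-- A norm one bound by trace duality, restricted to a finite-dimensional domain. -/
theorem norm_le_one_of_domain {H : Type u} [NormedAddCommGroup H] [NormedSpace 𝕜 H]
    [CompleteSpace H] [FiniteDimensional 𝕜 H] (hA : A.IsBanachIdeal)
    (ι : H →L[𝕜] F) (V : F →L[𝕜] M) (hι : ‖ι‖ ≤ 1)
    (hV : ∀ S : M →L[𝕜] F, ‖opTrace (V ∘L S)‖ ≤ A.adjoint.norm S) :
    A.norm (V ∘L ι) ≤ 1 := by
  by_contra! hlt
  set p := hA.seminormOfRange M H
  have hp : ∀ W, p W = A.norm W := fun W => rfl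
  obtain ⟨f, hfp, -, hf₀⟩ := p.exists_dual_of_forall_le ⊥ (V ∘L ι) (zero_lt_one.trans hlt)
    (fun y hy => by rw [(Submodule.mem_bot 𝕜).1 hy, add_zero, hp])
  obtain ⟨C, hC⟩ := hA.exists_norm_le_of_range M H
  obtain ⟨S, hS⟩ := exists_opTrace_eq f fun W => (hfp W).trans (hC W)
  -- Domination of `f` by `A` says `A*(ι S) ≤ 1`; then `hV` bounds `tr (V ι S) = f (V ι) = A(V ι) >
  -- 1` by `1`.
  have h1 : (1 : ℝ) ∈ A.adjointConstants (ι ∘L S) := by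
    refine ⟨zero_le_one, fun E₀ F₀ _ _ _ _ _ _ B W R _ hW _ => ?_⟩
    have hW0 := hA.norm_nonneg hW
    have h2 : finTrace ((ι ∘L S) ∘L B ∘L W ∘L R) = f (B ∘L W ∘L R ∘L ι) := by
      rw [hS, opTrace_comm]
      exact finTrace_comp_eq_opTrace (ι ∘L S) (B ∘L W ∘L R)
    rw [h2]
    refine (hfp _).trans ((hA.norm_comp_le B W (R ∘L ι) hW).trans ?_)
    rw [one_mul]
    gcongr
    exact (ContinuousLinearMap.opNorm_comp_le _ _).trans
      (mul_le_of_le_one_right (norm_nonneg R) hι)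
  have h3 := (hV (ι ∘L S)).trans (adjoint_norm_le h1)
  rw [← ContinuousLinearMap.comp_assoc, opTrace_comm, ← hS, hf₀, RCLike.norm_ofReal,
    abs_of_pos (zero_lt_one.trans hlt)] at h3
  linarith

/-- For a maximal ideal, the trace functionals dominated by the adjoint norm come from the unit
ball of the ideal. -/
theorem norm_le_one_of_isMaximal (hA : A.IsBanachIdeal) (hmax : A.IsMaximal) (V : F →L[𝕜] M)
    (hV : ∀ S : M →L[𝕜] F, ‖opTrace (V ∘L S)‖ ≤ A.adjoint.norm S) : A.norm V ≤ 1 := by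
  have hfin : ∀ (D : Type u) [NormedAddCommGroup D] [NormedSpace 𝕜 D] [CompleteSpace D]
      (Q : D →L[𝕜] F), FiniteRank Q → A.norm (V ∘L Q) ≤ ‖Q‖ := by
    intro D _ _ _ Q hQ
    obtain ⟨Q₀, hQ₀, hQn⟩ := hQ.exists_factorization
    have : FiniteDimensional 𝕜 (LinearMap.range (Q : D →ₗ[𝕜] F)) := hQ
    have : CompleteSpace (LinearMap.range (Q : D →ₗ[𝕜] F)) := FiniteDimensional.complete 𝕜 _
    have h1 := norm_le_one_of_domain hA (LinearMap.range (Q : D →ₗ[𝕜] F)).subtypeL V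
      (Submodule.norm_subtypeL_le _) hV
    calc A.norm (V ∘L Q) = A.norm ((V ∘L (LinearMap.range (Q : D →ₗ[𝕜] F)).subtypeL) ∘L Q₀) := by
          rw [ContinuousLinearMap.comp_assoc, ← hQ₀]
      _ ≤ A.norm (V ∘L (LinearMap.range (Q : D →ₗ[𝕜] F)).subtypeL) * ‖Q₀‖ :=
          hA.norm_comp_right_le (hA.mem_of_range _) Q₀
      _ ≤ 1 * ‖Q‖ := by gcongr
      _ = ‖Q‖ := one_mul _
  have happ : ∀ (D : Type u) [NormedAddCommGroup D] [NormedSpace 𝕜 D] [CompleteSpace D]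
      (Q : D →L[𝕜] F), Q ∈ closure {S : D →L[𝕜] F | FiniteRank S} → A.norm (V ∘L Q) ≤ ‖Q‖ := by
    intro D _ _ _ Q hQ
    have hV0 := hA.norm_nonneg (hA.mem_of_range V)
    refine le_of_forall_pos_le_add fun ε hε => ?_
    have hδ : 0 < ε / (A.norm V + 1) := by positivity
    obtain ⟨Q', hQ', hd⟩ := Metric.mem_closure_iff.1 hQ _ hδ
    rw [dist_eq_norm] at hd
    have h1 : V ∘L Q = V ∘L Q' + V ∘L (Q - Q') := by ext; simp
    have h2 := hA.norm_add_le (V ∘L Q') (V ∘L (Q - Q')) (hA.mem_of_range _) (hA.mem_of_range _)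
    have h3 := hA.norm_comp_right_le (hA.mem_of_range V) (Q - Q')
    have h4 : ‖Q'‖ ≤ ‖Q‖ + ‖Q - Q'‖ := by
      rw [norm_sub_rev]
      exact norm_le_insert' Q' Q
    have h5 : (A.norm V + 1) * ‖Q - Q'‖ ≤ ε := by
      rw [← le_div_iff₀' (by positivity)]
      exact hd.le
    rw [h1]
    linarith [hfin D Q' hQ']
  -- Maximality writes `A(V)` as a supremum of `A(R V Q)` over approximable `R`, `Q` of norm one.
  rw [(hmax V).2 (hA.mem_of_range V)]
  refine Real.sSup_le ?_ zero_le_one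
  rintro _ ⟨G, _, _, _, R, -, hR, rfl⟩
  refine Real.sSup_le ?_ zero_le_one
  rintro _ ⟨D, _, _, _, Q, hQ, hQn, rfl⟩
  have hR' : ‖R‖ = 1 := hR
  have hQn' : ‖Q‖ = 1 := hQn
  have h1 := hA.norm_comp_left_le (hA.mem_of_range (V ∘L Q)) R
  rw [hR', one_mul] at h1
  exact h1.trans ((happ D Q hQ).trans_eq hQn')

theorem adjoint_localReflexivityWith (hA : A.IsBanachIdeal) (hmax : A.IsMaximal)
    (hEP : A.HasExtensionProperty) : A.adjoint.LocalReflexivityWith A.adjoint := by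
  intro M F _ _ _ _ _ _ _ N _ T ε hε
  -- Separation needs a strict gap between `A*(T)` and `(1 + ε) A*(T)`. When `A*(T) = 0`, duality
  -- against rank one operators forces `T = 0`.
  rcases (A.adjoint_norm_nonneg T).eq_or_lt with h0 | h0
  · have hT : T = 0 := by
      ext1 x
      by_contra hx
      obtain ⟨φ, -, hφ⟩ := exists_dual_vector 𝕜 (T x) (norm_ne_zero_iff.2 hx)
      have h1 := norm_opTrace_comp_le hA hEP T (ContinuousLinearMap.smulRight φ x)
      have h2 : ContinuousLinearMap.smulRight φ x ∘L T =
          ContinuousLinearMap.smulRight (φ ∘L T) x := by ext; simp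
      rw [← h0, zero_mul, h2, opTrace_smulRight, ContinuousLinearMap.comp_apply, hφ,
        RCLike.norm_ofReal, abs_norm, norm_le_zero_iff] at h1
      exact hx h1
    refine ⟨0, hA.adjoint_mem_of_domain 0, ?_, fun x b _ => by simp [hT], fun x _ => by simp [hT]⟩
    rw [← h0, mul_zero]
    exact (map_zero (hA.adjointSeminorm M F)).le
  · obtain ⟨C, hC⟩ := hA.exists_mul_mem_adjointConstants M F
    obtain ⟨S, hS, hSN, hSj⟩ := exists_local_reflexive (hA.adjointSeminorm M F)
      (fun S => adjoint_norm_le (hC S)) N T (c := A.adjoint.norm T)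
      (c' := (1 + ε) * A.adjoint.norm T) (by positivity) (by nlinarith) fun V hV => by
        refine (norm_opTrace_bidualExt_comp_le hA hEP T V).trans ?_
        exact mul_le_of_le_one_right h0.le (norm_le_one_of_isMaximal hA hmax V hV)
    exact ⟨S, hA.adjoint_mem_of_domain S, hS.le, hSN, hSj⟩

end Ideal

end OpClass

end

theorem corollary4p1 {𝕜 : Type} [RCLike 𝕜] (A : OpClass.{u} 𝕜)
    (hA : A.IsBanachIdeal) (hmax : A.IsMaximal) (hEP : A.HasExtensionProperty) :
    A.adjoint.LRP ∧ A.adjoint.LocalReflexivityWith A.adjoint := by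
  have h := OpClass.adjoint_localReflexivityWith hA hmax hEP
  refine ⟨fun M F _ _ _ _ _ _ _ N _ T ε hε => ?_, h⟩
  obtain ⟨S, hS, hSn, hSN, hSj⟩ := h M F N T ε hε
  refine ⟨S, hS, hSn.trans ?_, hSN, hSj⟩
  gcongr
  exact OpClass.adjoint_norm_le_adjoint_adjoint_adjoint (fun T hT => hA.norm_nonneg hT)
    (hA.adjoint_mem_of_domain T)
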